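/- Let $F_n$ be the free group on the free basis $X=\{x_1,\dots,x_n\}$, and for a word $w$ on $X^{\pm1}$ let $w^{\mathrm{rev}}$ be the word read backwards. Let $\Pi A_n\le \mathrm{Aut}(F_n)$ be the palindromic automorphism group, i.e. the group of automorphisms taking each $x_i$ to an element that can be written as a palindrome on $X^{\pm1}$ (a word $w$ with $w^{\mathrm{rev}}=w$), and let $\mathcal{PI}_n\le \Pi A_n$ be the palindromic Torelli group, i.e. the subgroup of those elements of $\Pi A_n$ that act trivially on the abelianisation of $F_n$. For $i\ne j$ let $P_{ij}$ send $x_i\mapsto x_jx_ix_j$ and fix the other $x_k$; let $\iota_i$ send $x_i\mapsto x_i^{-1}$ and fix the other $x_k$; let $\mathrm{P}\Pi A_n$ be the group generated by all $P_{ij}$ and $\iota_i$. Write $[g,h]=ghg^{-1}h^{-1}$ and compose automorphisms from right to left. An element $\phi\in\mathcal{PI}_n$ is a doubled commutator transvection if there are $\alpha\in\Pi A_n$ and distinct members $y_1,y_2,y_3$ of $Y=\alpha(X)$ such that $\phi(y_1)=[y_2,y_3]^{\mathrm{rev}}\,y_1\,[y_2,y_3]$ and $\phi$ fixes the other members of $Y$.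 Let $\mathcal D_n$ be the group generated by the doubled commutator transvections. **Proposition.** Let $n\ge 3$. Then $\mathcal D_n$ is a proper subgroup of $\mathcal{PI}_n$. More precisely, let $W=\langle A,B\mid A^2=B^2=1\rangle$ be the free Coxeter group of rank $2$, and let $i,j,k\in\{1,\dots,n\}$ be pairwise distinct (for instance $1,2,3$). Then: 1. The separating $\pi$-twist $\chi_2=(P_{jk}P_{ik}^{-1}P_{ki}P_{kj}P_{ij}P_{ji}^{-1})^2$ lies in $\mathcal{PI}_n$ but not in $\mathcal D_n$. 2. There is a surjective homomorphism $\rho:\mathrm{P}\Pi A_n\to W$ that is trivial on $\mathcal D_n\cap \mathrm{P}\Pi A_n$, with $\rho(P_{ji})=A$, $\rho(P_{ij})=B$, with all other $P_{ab}$ and all $\iota_a$ mapped to $1$, and with $\rho(\chi_2)\neq 1$. 3. Let $Q_n$ be the group with generators $S_{ab}$, $O_a$ $(1\le a\ne b\le n)$ and the relators $(1)$ $O_a^2$, $(2)$ $[O_a,O_b]$, $(3)$ $(O_aS_{ab})^2$, $(4)$ $(O_bS_{ab})^2$, $(5)$ $[O_a,S_{bc}]$, $(6)$ $[S_{ca},S_{cb}]$,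 $(7)$ $[S_{ab},S_{cd}]$, $(8)$ $[S_{ba},S_{ca}]$, $(9)$ $[S_{cb},S_{ba}]S_{ca}^{-2}$, where $a,b,c,d$ are pairwise different (so there is no relator $(7)$ for $n=3$), but without the relators $(10)$ $(S_{ab}S_{ac}^{-1}S_{ca}S_{ba}S_{bc}S_{cb}^{-1})^2$. There is a surjective homomorphism $\sigma:Q_n\to W$ with $\sigma(S_{ij})=A$, $\sigma(S_{ji})=B$, with all other $S_{ab}$ and all $O_a$ mapped to $1$, and with $\sigma(\xi)\ne1$, where $\xi=(S_{kj}S_{ki}^{-1}S_{ik}S_{jk}S_{ji}S_{ij}^{-1})^2$ is a word of type $(10)$ corresponding to $\chi_2$ under $P_{ab}\leftrightarrow S_{ba}$. In particular $\xi\neq 1$ in $Q_n$. -/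

import Mathlib

namespace PalTorelli

open scoped commutatorElement

/-- The free group `F_n` on the fixed free basis `x_i = FreeGroup.of i`, `i : Fin n`. -/
abbrev F (n : ℕ) : Type := FreeGroup (Fin n)

/-- The reverse `g ^ rev` of an element of `F_n`: the anti-automorphism of `F_n` that fixes every
member of the basis. On words it reverses the order of the letters, see `rev_mk`. -/
def rev {n : ℕ} (g : F n) : F n :=
  (FreeGroup.lift (fun i : Fin n => MulOpposite.op (FreeGroup.of i)) g).unop

theorem rev_mul {n : ℕ} (g h : F n) : rev (g * h) = rev h * rev g := by
  simp [rev]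

theorem rev_inv {n : ℕ} (g : F n) : rev g⁻¹ = (rev g)⁻¹ := by
  simp [rev]

theorem rev_of {n : ℕ} (i : Fin n) : rev (FreeGroup.of i) = FreeGroup.of i := by
  simp [rev]

theorem rev_one {n : ℕ} : rev (1 : F n) = 1 := by
  simp [rev]

theorem rev_mk {n : ℕ} (L : List (Fin n × Bool)) :
    rev (FreeGroup.mk L) = FreeGroup.mk L.reverse := by
  induction L with
  | nil => exact rev_one
  | cons a L ih =>
    have h1 : (FreeGroup.mk (a :: L) : F n) = FreeGroup.mk [a] * FreeGroup.mk L := by simp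
    have h2 : (FreeGroup.mk (a :: L).reverse : F n)
        = FreeGroup.mk L.reverse * FreeGroup.mk [a] := by simp
    have h3 : rev (FreeGroup.mk [a] : F n) = FreeGroup.mk [a] := by
      obtain ⟨i, b⟩ := a
      cases b with
      | true => exact rev_of i
      | false =>
        have h4 : (FreeGroup.mk [(i, false)] : F n) = (FreeGroup.of i)⁻¹ := by
          simp [FreeGroup.of, FreeGroup.inv_mk, FreeGroup.invRev]
        rw [h4, rev_inv, rev_of]
    rw [h1, rev_mul, ih, h2, h3]

/-- `g` may be written as a palindrome on the letters `x_i`, `x_i⁻¹`. -/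
def IsPalindrome {n : ℕ} (g : F n) : Prop :=
  ∃ L : List (Fin n × Bool), L.Palindrome ∧ FreeGroup.mk L = g

theorem isPalindrome_iff {n : ℕ} (g : F n) : IsPalindrome g ↔ rev g = g := by
  constructor
  · rintro ⟨L, hL, rfl⟩
    rw [rev_mk, hL.reverse_eq]
  · intro h
    refine ⟨g.toWord, List.Palindrome.of_reverse_eq ?_, FreeGroup.mk_toWord⟩
    have hred : FreeGroup.IsReduced g.toWord.reverse := by
      have h0 : FreeGroup.IsReduced g.toWord := FreeGroup.isReduced_toWord
      unfold FreeGroup.IsReduced at h0 ⊢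
      rw [List.isChain_reverse]
      exact h0.imp (fun a b hab e => (hab e.symm).symm)
    have h5 : FreeGroup.mk g.toWord.reverse = g := by
      rw [← rev_mk, FreeGroup.mk_toWord, h]
    have h6 := congrArg FreeGroup.toWord h5
    rw [FreeGroup.toWord_mk, hred.reduce_eq] at h6
    exact h6

/-- If `α` maps the basis to palindromes, then it commutes with reversal. -/
theorem rev_map {n : ℕ} (α : MulAut (F n))
    (h : ∀ i, IsPalindrome (α (FreeGroup.of i))) (g : F n) : rev (α g) = α (rev g) := by
  induction g using FreeGroup.induction_on with
  | C1 => simp [rev_one]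
  | of i => rw [rev_of]; exact (isPalindrome_iff _).1 (h i)
  | inv_of i hi => rw [map_inv, rev_inv, rev_inv, map_inv, hi]
  | mul x y hx hy => rw [map_mul, rev_mul, rev_mul, map_mul, hx, hy]

/-- The palindromic automorphism group `ΠA_n`: the automorphisms of `F_n` that take each member of
the basis to a palindrome. -/
def palAut (n : ℕ) : Subgroup (MulAut (F n)) where
  carrier := {α | ∀ i, IsPalindrome (α (FreeGroup.of i))}
  one_mem' := fun i => (isPalindrome_iff _).2 (rev_of i)
  mul_mem' := by
    intro α β hα hβ i
    rw [isPalindrome_iff, MulAut.mul_apply, rev_map α hα, (isPalindrome_iff _).1 (hβ i)]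
  inv_mem' := by
    intro α hα i
    rw [isPalindrome_iff]
    apply α.injective
    rw [← rev_map α hα, MulAut.apply_inv_self, rev_of]

/-- The palindromic Torelli group `PI_n`: the elements of `ΠA_n` that act trivially on the
abelianisation of `F_n`. -/
def palTorelli (n : ℕ) : Subgroup (MulAut (F n)) where
  carrier := {α | α ∈ palAut n ∧
    ∀ g : F n, Abelianization.of (α g) = Abelianization.of g}
  one_mem' := ⟨one_mem _, fun _ => rfl⟩
  mul_mem' := by
    rintro α β ⟨hα, hα'⟩ ⟨hβ, hβ'⟩
    exact ⟨mul_mem hα hβ, fun g => by rw [MulAut.mul_apply, hα', hβ']⟩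
  inv_mem' := by
    rintro α ⟨hα, hα'⟩
    exact ⟨inv_mem hα, fun g => by rw [← hα' (α⁻¹ g), MulAut.apply_inv_self]⟩

/-- `φ ∈ PI_n` is a doubled commutator transvection: there are a `π`-basis
`Y = {α x_l}` (`α ∈ ΠA_n`) and distinct members `y₁ = α x_i`, `y₂ = α x_j`, `y₃ = α x_k` of it
such that `φ` maps `y₁` to `[y₂, y₃]^rev y₁ [y₂, y₃]` and fixes the other members of `Y`. -/
def IsDoubledCommutatorTransvection {n : ℕ} (φ : MulAut (F n)) : Prop :=
  φ ∈ palTorelli n ∧ ∃ α ∈ palAut n, ∃ i j k : Fin n, i ≠ j ∧ i ≠ k ∧ j ≠ k ∧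
    φ (α (FreeGroup.of i)) =
      rev ⁅α (FreeGroup.of j), α (FreeGroup.of k)⁆ * α (FreeGroup.of i) *
        ⁅α (FreeGroup.of j), α (FreeGroup.of k)⁆ ∧
    ∀ l, l ≠ i → φ (α (FreeGroup.of l)) = α (FreeGroup.of l)

/-- The subgroup generated by the doubled commutator transvections. -/
def doubledCommutatorSubgroup (n : ℕ) : Subgroup (MulAut (F n)) :=
  Subgroup.closure {φ | IsDoubledCommutatorTransvection φ}

/-- The endomorphism `x_i ↦ x_j ^ e x_i x_j ^ e`, `x_k ↦ x_k` for `k ≠ i`. -/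
def elemHom {n : ℕ} (i j : Fin n) (e : ℤ) : F n →* F n :=
  FreeGroup.lift fun k =>
    if k = i then FreeGroup.of j ^ e * FreeGroup.of i * FreeGroup.of j ^ e else FreeGroup.of k

theorem elemHom_comp {n : ℕ} {i j : Fin n} (h : i ≠ j) (e : ℤ) :
    (elemHom i j (-e)).comp (elemHom i j e) = MonoidHom.id (F n) := by
  ext k
  by_cases hk : k = i
  · subst hk
    simp [elemHom, h.symm, mul_assoc]
  · simp [elemHom, hk]

/-- The elementary palindromic automorphism `P_ij`: `x_i ↦ x_j x_i x_j`, `x_k ↦ x_k` for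
`k ≠ i`. -/
def P {n : ℕ} (i j : Fin n) (h : i ≠ j) : MulAut (F n) :=
  (elemHom i j 1).toMulEquiv (elemHom i j (-1)) (elemHom_comp h 1)
    (by simpa only [neg_neg] using elemHom_comp h (-1))

/-- The endomorphism `x_i ↦ x_i⁻¹`, `x_k ↦ x_k` for `k ≠ i`. -/
def invHom {n : ℕ} (i : Fin n) : F n →* F n :=
  FreeGroup.lift fun k => if k = i then (FreeGroup.of i)⁻¹ else FreeGroup.of k

theorem invHom_comp {n : ℕ} (i : Fin n) :
    (invHom i).comp (invHom i) = MonoidHom.id (F n) := by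
  ext k
  by_cases hk : k = i
  · subst hk
    simp [invHom]
  · simp [invHom, hk]

/-- The inversion `ι_i`: `x_i ↦ x_i⁻¹`, `x_k ↦ x_k` for `k ≠ i`. -/
def inversion {n : ℕ} (i : Fin n) : MulAut (F n) :=
  (invHom i).toMulEquiv (invHom i) (invHom_comp i) (invHom_comp i)

/-- The pure palindromic automorphism group `PΠA_n`, generated by the elementary palindromic
automorphisms and the inversions. -/
def purePalAut (n : ℕ) : Subgroup (MulAut (F n)) :=
  Subgroup.closure ({φ | ∃ i j, ∃ h : i ≠ j, φ = P i j h} ∪ {φ | ∃ i, φ = inversion i})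

/-- `P_ij` as an element of `PΠA_n`. -/
def pureP {n : ℕ} (i j : Fin n) (h : i ≠ j) : purePalAut n :=
  ⟨P i j h, Subgroup.subset_closure (Or.inl ⟨i, j, h, rfl⟩)⟩

/-- `ι_i` as an element of `PΠA_n`. -/
def pureInversion {n : ℕ} (i : Fin n) : purePalAut n :=
  ⟨inversion i, Subgroup.subset_closure (Or.inr ⟨i, rfl⟩)⟩

/-- `χ₂ = (P_23 P_13⁻¹ P_31 P_32 P_12 P_21⁻¹)²`, where the indices `1, 2, 3` are `i, j, k`. -/
def chi2 {n : ℕ} (i j k : Fin n) (hij : i ≠ j) (hik : i ≠ k) (hjk : j ≠ k) : purePalAut n :=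
  (pureP j k hjk * (pureP i k hik)⁻¹ * pureP k i hik.symm * pureP k j hjk.symm *
    pureP i j hij * (pureP j i hij.symm)⁻¹) ^ 2

/-- The formal generators `S_ij` (`i ≠ j`) and `O_i`. -/
inductive Gen (n : ℕ) : Type
  | S (i j : Fin n) (h : i ≠ j) : Gen n
  | O (i : Fin n) : Gen n

/-- `S_ij` in the free group on the formal generators. -/
def fS {n : ℕ} (i j : Fin n) (h : i ≠ j) : FreeGroup (Gen n) := FreeGroup.of (Gen.S i j h)

/-- `O_i` in the free group on the formal generators. -/
def fO {n : ℕ} (i : Fin n) : FreeGroup (Gen n) := FreeGroup.of (Gen.O i)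

/-- The relators (1)-(9) of the standard presentation of the level 2 congruence subgroup of
`GL(n, ℤ)`, i.e. all of them except the relators
(10) `(S_ij S_ik⁻¹ S_ki S_ji S_jk S_kj⁻¹)²`. Different letters are different indices. -/
inductive Relator (n : ℕ) : FreeGroup (Gen n) → Prop
  | r1 (i : Fin n) : Relator n (fO i ^ 2)
  | r2 (i j : Fin n) (hij : i ≠ j) : Relator n ⁅fO i, fO j⁆
  | r3 (i j : Fin n) (hij : i ≠ j) : Relator n ((fO i * fS i j hij) ^ 2)
  | r4 (i j : Fin n) (hij : i ≠ j) : Relator n ((fO j * fS i j hij) ^ 2)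
  | r5 (i j k : Fin n) (hij : i ≠ j) (hik : i ≠ k) (hjk : j ≠ k) :
      Relator n ⁅fO i, fS j k hjk⁆
  | r6 (i j k : Fin n) (hij : i ≠ j) (hki : k ≠ i) (hkj : k ≠ j) :
      Relator n ⁅fS k i hki, fS k j hkj⁆
  | r7 (i j k l : Fin n) (hij : i ≠ j) (hik : i ≠ k) (hil : i ≠ l) (hjk : j ≠ k) (hjl : j ≠ l)
      (hkl : k ≠ l) : Relator n ⁅fS i j hij, fS k l hkl⁆
  | r8 (i j k : Fin n) (hji : j ≠ i) (hki : k ≠ i) (hjk : j ≠ k) :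
      Relator n ⁅fS j i hji, fS k i hki⁆
  | r9 (i j k : Fin n) (hji : j ≠ i) (hki : k ≠ i) (hkj : k ≠ j) :
      Relator n (⁅fS k j hkj, fS j i hji⁆ * (fS k i hki ^ 2)⁻¹)

/-- The group presented by the generators `S_ij`, `O_i` and the relators (1)-(9). -/
abbrev Q (n : ℕ) : Type := PresentedGroup {r : FreeGroup (Gen n) | Relator n r}

/-- `S_ij` in `Q n`. -/
def qS {n : ℕ} (i j : Fin n) (h : i ≠ j) : Q n := PresentedGroup.of (Gen.S i j h)

/-- `O_i` in `Q n`. -/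
def qO {n : ℕ} (i : Fin n) : Q n := PresentedGroup.of (Gen.O i)

/-- `ξ = (S_32 S_31⁻¹ S_13 S_23 S_21 S_12⁻¹)²` in `Q n`, where the indices `1, 2, 3` are
`i, j, k`. This is a relator of type (10). -/
def xi {n : ℕ} (i j k : Fin n) (hij : i ≠ j) (hik : i ≠ k) (hjk : j ≠ k) : Q n :=
  (qS k j hjk.symm * (qS k i hik.symm)⁻¹ * qS i k hik * qS j k hjk *
    qS j i hij.symm * (qS i j hij)⁻¹) ^ 2

/-- The Coxeter matrix of the free Coxeter group of rank 2: no relation between the two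
generators (the entry `0` stands for `∞`). -/
def freeCoxeterMatrix : CoxeterMatrix (Fin 2) where
  M := fun a b => if a = b then 1 else 0
  isSymm := by
    ext a b
    show (if b = a then 1 else 0) = (if a = b then 1 else 0)
    simp [eq_comm]
  diagonal := by simp
  off_diagonal := by
    intro a b h
    simp [h]

/-- The free Coxeter group `⟨A, B ∣ A² = B² = 1⟩`. -/
abbrev W : Type := freeCoxeterMatrix.Group

/-- The generator `A` of the free Coxeter group. -/
def A : W := freeCoxeterMatrix.simple 0

/-- The generator `B` of the free Coxeter group. -/
def B : W := freeCoxeterMatrix.simple 1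

end PalTorelli

/-!
Let `F n` act on `ℤ × ℤ` so that `x_i` and `x_j` are the two unit translations and every other
`x_l` is `z ↦ -z`. A palindromic automorphism sends each `x_l` to some `u x_m u^rev`, where
`l ↦ m` is a permutation; so it carries such an action to another one of this kind, for a possibly
different pair of indices, through a linear map that is trivial modulo two. For elements of
`PΠA_n` the pair stays the same, and `P_ji`, `P_ij` become the shears `(a, c) ↦ (a + 2 c, c)` and
`(a, c) ↦ (a, c + 2 a)`, while the other generators become diagonal.

The Euclidean algorithm with even quotients attaches an integer height to each vector with odd
first and even second entry. The level two congruence subgroup of `GL(2, ℤ)` acts on heights as the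
infinite dihedral group `W`; the shears act as the generators `A` and `B`, the diagonal matrices
trivially. This gives `ρ`. A commutator of two of the other basis elements acts as a translation by
an even multiple of a unit vector, so a doubled commutator transvection of the standard basis
becomes an even power of a shear and acts trivially. A change of the basis by `ΠA_n` conjugates
this by a matrix of level two, hence `ρ` is trivial on `𝓓_n`, whereas it maps `χ₂` to
`(B A)² ≠ 1`.
-/

namespace PalTorelli

open scoped commutatorElement

/-! ### The free Coxeter group of rank two as the infinite dihedral group -/

/-- The action of `W` on `ℤ` as the infinite dihedral group: `A` acts by `m ↦ -m` and `B` by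
`m ↦ 1 - m`. It serves to tell elements of `W` apart. -/
def dihedralAction : W →* Equiv.Perm ℤ :=
  freeCoxeterMatrix.toCoxeterSystem.lift
    ⟨![Equiv.neg ℤ, Equiv.subLeft 1], by
      intro a b
      obtain rfl | h := eq_or_ne a b
      · rw [freeCoxeterMatrix.diagonal, pow_one]
        ext m
        fin_cases a <;> simp
      · rw [show freeCoxeterMatrix a b = 0 from if_neg h, pow_zero]⟩

theorem dihedralAction_A (m : ℤ) : dihedralAction A m = -m := by
  have h : dihedralAction A = Equiv.neg ℤ :=
    freeCoxeterMatrix.toCoxeterSystem.lift_apply_simple _ 0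
  rw [h, Equiv.neg_apply]

theorem dihedralAction_B (m : ℤ) : dihedralAction B m = 1 - m := by
  have h : dihedralAction B = Equiv.subLeft 1 :=
    freeCoxeterMatrix.toCoxeterSystem.lift_apply_simple _ 1
  rw [h, Equiv.subLeft_apply]

theorem A_mul_A : A * A = 1 := freeCoxeterMatrix.toCoxeterSystem.simple_mul_simple_self 0

theorem B_mul_B : B * B = 1 := freeCoxeterMatrix.toCoxeterSystem.simple_mul_simple_self 1

theorem A_inv : A⁻¹ = A := inv_eq_of_mul_eq_one_left A_mul_A

theorem exists_eq_zpow_or_eq_A_mul_zpow (w : W) :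
    ∃ m : ℤ, w = (B * A) ^ m ∨ w = A * (B * A) ^ m := by
  induction w using freeCoxeterMatrix.toCoxeterSystem.simple_induction_left with
  | one => exact ⟨0, .inl (zpow_zero _).symm⟩
  | mul_simple_left w a ih =>
    obtain ⟨m, hm⟩ := ih
    fin_cases a
    · change ∃ l : ℤ, A * w = _ ∨ A * w = _
      rcases hm with rfl | rfl
      · exact ⟨m, .inr rfl⟩
      · exact ⟨m, .inl (by rw [← mul_assoc, A_mul_A, one_mul])⟩
    · change ∃ l : ℤ, B * w = _ ∨ B * w = _
      rcases hm with rfl | rfl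
      · have h := zpow_one_add (B * A) (m - 1)
        rw [add_sub_cancel] at h
        exact ⟨m - 1, .inr (by rw [h, mul_assoc B, ← mul_assoc, B_mul_B, one_mul])⟩
      · exact ⟨1 + m, .inl (by rw [← mul_assoc, zpow_one_add])⟩

theorem dihedralAction_zpow (m l : ℤ) : dihedralAction ((B * A) ^ m) l = l + m := by
  have h : dihedralAction (B * A) = Equiv.addRight 1 := by
    ext x
    rw [map_mul, Equiv.Perm.mul_apply, dihedralAction_A, dihedralAction_B, Equiv.coe_addRight]
    ring
  rw [map_zpow, h, Equiv.zsmul_addRight, Equiv.coe_addRight, Int.zsmul_eq_mul, mul_one]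

theorem eq_one_of_dihedralAction {w : W} (h0 : dihedralAction w 0 = 0)
    (h1 : dihedralAction w 1 = 1) : w = 1 := by
  obtain ⟨m, rfl | rfl⟩ := exists_eq_zpow_or_eq_A_mul_zpow w
  · rw [dihedralAction_zpow, zero_add] at h0
    rw [h0, zpow_zero]
  · rw [map_mul, Equiv.Perm.mul_apply, dihedralAction_zpow, dihedralAction_A] at h0 h1
    omega

theorem eq_of_dihedralAction {w w' : W} (h0 : dihedralAction w 0 = dihedralAction w' 0)
    (h1 : dihedralAction w 1 = dihedralAction w' 1) : w = w' := by
  rw [← inv_mul_eq_one]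
  apply eq_one_of_dihedralAction <;>
    rw [map_mul, map_inv, Equiv.Perm.mul_apply, Equiv.Perm.inv_eq_iff_eq] <;> simp only [h0, h1]

theorem sq_B_mul_A_ne_one : (B * A) ^ 2 ≠ 1 := by
  intro h
  have h2 := dihedralAction_zpow 2 0
  rw [zpow_ofNat, h, map_one] at h2
  exact absurd h2 (by decide)

theorem surjective_of_apply_eq_A_of_apply_eq_B {G : Type*} [Group G] (f : G →* W) {a b : G}
    (ha : f a = A) (hb : f b = B) : Function.Surjective f := by
  rw [← MonoidHom.range_eq_top, eq_top_iff,
    ← freeCoxeterMatrix.toCoxeterSystem.subgroup_closure_range_simple, Subgroup.closure_le]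
  rintro _ ⟨c, rfl⟩
  fin_cases c
  · exact ⟨a, ha⟩
  · exact ⟨b, hb⟩

/-! ### Heights and the level two congruence subgroup of `GL(2, ℤ)` -/

/-- The signed number of steps of the Euclidean algorithm with even quotients, which replaces the
larger entry of `(a, c)` by its distance from twice the smaller one: a step in the first entry
acts by `m ↦ -m`, a step in the second one by `m ↦ 1 - m`. The algorithm stops when `a = 0`,
`c = 0` or `a = c`. -/
def evenEuclid (a c : ℕ) : ℤ :=
  if c = 0 then 0
  else if c < a then -evenEuclid ((a : ℤ) - 2 * c).natAbs c
  else if 0 < a ∧ a < c then 1 - evenEuclid a ((c : ℤ) - 2 * a).natAbs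
  else 0
termination_by a + c
decreasing_by all_goals omega

/-- The height of a vector `(a, c)` is `evenEuclid |a| |c|`. On the vectors with `a` odd and `c`
even, which the algorithm never sends to `a = c`, it turns shears into the action of `W`
on `ℤ`. -/
def height (z : ℤ × ℤ) : ℤ := evenEuclid z.1.natAbs z.2.natAbs

theorem evenEuclid_zero_right (a : ℕ) : evenEuclid a 0 = 0 := by
  rw [evenEuclid, if_pos rfl]

theorem evenEuclid_of_gt {a c : ℕ} (h : c < a) :
    evenEuclid a c = -evenEuclid ((a : ℤ) - 2 * c).natAbs c := by
  obtain rfl | hc := eq_or_ne c 0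
  · simp only [evenEuclid_zero_right, neg_zero]
  · rw [evenEuclid, if_neg hc, if_pos h]

theorem evenEuclid_of_lt {a c : ℕ} (ha : 0 < a) (h : a < c) :
    evenEuclid a c = 1 - evenEuclid a ((c : ℤ) - 2 * a).natAbs := by
  rw [evenEuclid, if_neg (by lia), if_neg (by lia), if_pos ⟨ha, h⟩]

theorem height_add_two_mul_left {a c : ℤ} (h : a.natAbs ≠ c.natAbs) :
    height (a + 2 * c, c) = -height (a, c) := by
  obtain ⟨hlt, hstep⟩ | ⟨hlt, hstep⟩ :
      (c.natAbs < a.natAbs ∧ ((a.natAbs : ℤ) - 2 * c.natAbs).natAbs = (a + 2 * c).natAbs) ∨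
      (c.natAbs < (a + 2 * c).natAbs ∧
        (((a + 2 * c).natAbs : ℤ) - 2 * c.natAbs).natAbs = a.natAbs) := by omega
  · simp only [height, evenEuclid_of_gt hlt, hstep, neg_neg]
  · simp only [height, evenEuclid_of_gt hlt, hstep]

theorem height_add_two_mul_right {a c : ℤ} (ha : a ≠ 0) (h : a.natAbs ≠ c.natAbs) :
    height (a, c + 2 * a) = 1 - height (a, c) := by
  have ha' : 0 < a.natAbs := Int.natAbs_pos.2 ha
  obtain ⟨hlt, hstep⟩ | ⟨hlt, hstep⟩ :
      (a.natAbs < c.natAbs ∧ ((c.natAbs : ℤ) - 2 * a.natAbs).natAbs = (c + 2 * a).natAbs) ∨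
      (a.natAbs < (c + 2 * a).natAbs ∧
        (((c + 2 * a).natAbs : ℤ) - 2 * a.natAbs).natAbs = c.natAbs) := by omega
  · simp only [height, evenEuclid_of_lt ha' hlt, hstep, sub_sub_cancel]
  · simp only [height, evenEuclid_of_lt ha' hlt, hstep]

/-- The level two congruence subgroup: the automorphisms of `V` that are trivial modulo two. -/
def levelTwo (V : Type*) [AddCommGroup V] : Subgroup (V ≃ₗ[ℤ] V) where
  carrier := {M | ∀ z, ∃ y, M z = z + (2 : ℤ) • y}
  one_mem' := fun z => ⟨0, by rw [smul_zero, add_zero]; rfl⟩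
  mul_mem' := by
    intro M N hM hN z
    obtain ⟨y, hy⟩ := hN z
    obtain ⟨x, hx⟩ := hM (N z)
    exact ⟨y + x, by rw [LinearEquiv.mul_apply, hx, hy, smul_add, add_assoc]⟩
  inv_mem' := by
    intro M hM z
    obtain ⟨y, hy⟩ := hM (M⁻¹ z)
    refine ⟨-y, ?_⟩
    rw [smul_neg, ← sub_eq_add_neg, eq_sub_iff_add_eq, ← hy]
    exact M.apply_symm_apply z

theorem odd_and_even_of_mem_levelTwo {M : (ℤ × ℤ) ≃ₗ[ℤ] ℤ × ℤ} (hM : M ∈ levelTwo (ℤ × ℤ))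
    {z : ℤ × ℤ} (h : Odd z.1 ∧ Even z.2) : Odd (M z).1 ∧ Even (M z).2 := by
  obtain ⟨y, hy⟩ := hM z
  simpa [hy, Int.odd_add, Int.even_add] using h

theorem transvection_zpow_apply {R V : Type*} [Ring R] [AddCommGroup V] [Module R V]
    {f : Module.Dual R V} {v : V} (h : f v = 0) (m : ℤ) (x : V) :
    (LinearEquiv.transvection h ^ m) x = x + (m * f x) • v := by
  induction m generalizing x with
  | zero => simp
  | succ m ih =>
    rw [zpow_add_one, LinearEquiv.mul_apply, ih, LinearEquiv.transvection.apply]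
    simp [h, add_smul, add_mul, add_assoc, add_comm]
  | pred m ih =>
    rw [zpow_sub_one, LinearEquiv.mul_apply, ih, LinearEquiv.transvection.inv_eq h (by simp [h]),
      LinearEquiv.transvection.apply]
    simp [h, sub_mul, sub_smul]
    abel

/-- The elementary automorphism `(a, c) ↦ (a + 2 c, c)`. -/
def upperShear : (ℤ × ℤ) ≃ₗ[ℤ] ℤ × ℤ :=
  LinearEquiv.transvection (f := LinearMap.snd ℤ ℤ ℤ) (v := (2, 0)) (LinearMap.snd_apply _)

/-- The elementary automorphism `(a, c) ↦ (a, c + 2 a)`. -/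
def lowerShear : (ℤ × ℤ) ≃ₗ[ℤ] ℤ × ℤ :=
  LinearEquiv.transvection (f := LinearMap.fst ℤ ℤ ℤ) (v := (0, 2)) (LinearMap.fst_apply _)

/-- The diagonal automorphism `(a, c) ↦ (s a, t c)`. -/
def diag (s t : ℤˣ) : (ℤ × ℤ) ≃ₗ[ℤ] ℤ × ℤ :=
  (LinearEquiv.smulOfUnit s).prodCongr (LinearEquiv.smulOfUnit t)

theorem upperShear_zpow_apply (m : ℤ) (z : ℤ × ℤ) :
    (upperShear ^ m) z = (z.1 + 2 * (m * z.2), z.2) := by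
  rw [upperShear, transvection_zpow_apply]
  ext <;> simp [mul_comm]

theorem lowerShear_zpow_apply (m : ℤ) (z : ℤ × ℤ) :
    (lowerShear ^ m) z = (z.1, z.2 + 2 * (m * z.1)) := by
  rw [lowerShear, transvection_zpow_apply]
  ext <;> simp [mul_comm]

theorem diag_apply (s t : ℤˣ) (z : ℤ × ℤ) : diag s t z = (s * z.1, t * z.2) := rfl

theorem upperShear_mem_levelTwo : upperShear ∈ levelTwo (ℤ × ℤ) := fun z =>
  ⟨(z.2, 0), by rw [← zpow_one upperShear, upperShear_zpow_apply]; ext <;> simp⟩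

theorem lowerShear_mem_levelTwo : lowerShear ∈ levelTwo (ℤ × ℤ) := fun z =>
  ⟨(0, z.1), by rw [← zpow_one lowerShear, lowerShear_zpow_apply]; ext <;> simp⟩

theorem diag_mem_levelTwo (s t : ℤˣ) : diag s t ∈ levelTwo (ℤ × ℤ) := by
  have odd (u : ℤˣ) : ∃ y : ℤ, (u : ℤ) = 1 + 2 * y := by
    obtain rfl | rfl := Int.units_eq_one_or u
    exacts [⟨0, rfl⟩, ⟨-1, rfl⟩]
  intro z
  obtain ⟨x, hx⟩ := odd s
  obtain ⟨y, hy⟩ := odd t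
  exact ⟨(x * z.1, y * z.2), by rw [diag_apply, hx, hy]; ext <;> simp <;> ring⟩

theorem eq_upperShear_zpow_mul_diag {M : (ℤ × ℤ) ≃ₗ[ℤ] ℤ × ℤ} (hM : M ∈ levelTwo (ℤ × ℤ))
    (h : (M (1, 0)).2 = 0) : ∃ (m : ℤ) (s t : ℤˣ), M = upperShear ^ m * diag s t := by
  have hM_apply (z : ℤ × ℤ) : M z = z.1 • M (1, 0) + z.2 • M (0, 1) := by
    rw [← map_smul, ← map_smul, ← map_add]
    simp
  obtain ⟨z, hz⟩ := M.surjective (0, 1)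
  obtain ⟨t, ht⟩ : IsUnit (M (0, 1)).2 :=
    .of_mul_eq_one z.2 (by simpa [h, mul_comm] using congrArg Prod.snd ((hM_apply z).symm.trans hz))
  obtain ⟨s, hs⟩ : IsUnit (M (1, 0)).1 := by
    have h1 : (1, 0) = (M (1, 0)).1 • M.symm (1, 0) := by
      rw [← map_smul, M.eq_symm_apply]
      ext <;> simp [h]
    exact .of_mul_eq_one _ (congrArg Prod.fst h1).symm
  obtain ⟨y, hy⟩ := hM (0, 1)
  refine ⟨y.1 * t, s, t, LinearEquiv.ext fun z => ?_⟩
  have htt : (t * t : ℤ) = 1 := Int.isUnit_mul_self t.isUnit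
  rw [LinearEquiv.mul_apply, upperShear_zpow_apply, diag_apply, hM_apply]
  ext
  · simp [← hs, hy]
    linear_combination (-2 * y.1 * z.2) * htt
  · simp [h, ← ht, mul_comm]

theorem levelTwo_le_closure : levelTwo (ℤ × ℤ) ≤
    Subgroup.closure ({upperShear, lowerShear} ∪ Set.range fun u : ℤˣ × ℤˣ => diag u.1 u.2) := by
  set S := Subgroup.closure ({upperShear, lowerShear} ∪ Set.range fun u : ℤˣ × ℤˣ => diag u.1 u.2)
  have upper_mem : upperShear ∈ S := Subgroup.subset_closure (by simp)
  have lower_mem : lowerShear ∈ S := Subgroup.subset_closure (by simp)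
  have diag_mem (s t : ℤˣ) : diag s t ∈ S := Subgroup.subset_closure (by simp)
  intro M hM
  induction hN : (M (1, 0)).1.natAbs + (M (1, 0)).2.natAbs using Nat.strong_induction_on
    generalizing M with
  | _ N ih =>
  obtain h0 | h0 := eq_or_ne (M (1, 0)).2 0
  · obtain ⟨m, s, t, rfl⟩ := eq_upperShear_zpow_mul_diag hM h0
    exact mul_mem (zpow_mem upper_mem m) (diag_mem s t)
  have reduce {E : (ℤ × ℤ) ≃ₗ[ℤ] ℤ × ℤ} (hE : E ∈ S) (hE' : E ∈ levelTwo (ℤ × ℤ))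
      (hlt : (E (M (1, 0))).1.natAbs + (E (M (1, 0))).2.natAbs < N) : M ∈ S :=
    (Subgroup.mul_mem_cancel_left S hE).1 (ih _ hlt (mul_mem hE' hM) rfl)
  obtain ⟨⟨x, hx⟩, y, hy⟩ := odd_and_even_of_mem_levelTwo hM (z := (1, 0)) (by decide)
  obtain ⟨m, hm⟩ : ∃ m : ℤ, ((upperShear ^ m) (M (1, 0))).1.natAbs < (M (1, 0)).1.natAbs ∨
      ((lowerShear ^ m) (M (1, 0))).2.natAbs < (M (1, 0)).2.natAbs := by
    simp only [upperShear_zpow_apply, lowerShear_zpow_apply]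
    by_contra! hcontra
    have hneg := hcontra (-1)
    have hpos := hcontra 1
    omega
  rcases hm with hm | hm
  · refine reduce (zpow_mem upper_mem m) (zpow_mem upperShear_mem_levelTwo m) ?_
    simp only [upperShear_zpow_apply] at hm ⊢
    omega
  · refine reduce (zpow_mem lower_mem m) (zpow_mem lowerShear_mem_levelTwo m) ?_
    simp only [lowerShear_zpow_apply] at hm ⊢
    omega

/-- The pairs `(M, w)` for which the action of `M` on the heights of the vectors with odd first and
even second entry is the action of `w` on `ℤ`. This is the graph of a homomorphism from
`levelTwo (ℤ × ℤ)` to `W`, see `exists_mem_heightGraph` and `eq_of_mem_heightGraph`. -/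
def heightGraph : Subgroup (((ℤ × ℤ) ≃ₗ[ℤ] ℤ × ℤ) × W) where
  carrier := {p | p.1 ∈ levelTwo (ℤ × ℤ) ∧
    ∀ z : ℤ × ℤ, Odd z.1 ∧ Even z.2 → height (p.1 z) = dihedralAction p.2 (height z)}
  one_mem' := ⟨one_mem _, fun _ _ => by simp⟩
  mul_mem' := by
    rintro ⟨M, w⟩ ⟨N, v⟩ ⟨hM, hw⟩ ⟨hN, hv⟩
    refine ⟨mul_mem hM hN, fun z hz => ?_⟩
    rw [Prod.mk_mul_mk, LinearEquiv.mul_apply, hw _ (odd_and_even_of_mem_levelTwo hN hz), hv z hz,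
      map_mul, Equiv.Perm.mul_apply]
  inv_mem' := by
    rintro ⟨M, w⟩ ⟨hM, hw⟩
    refine ⟨inv_mem hM, fun z hz => ?_⟩
    have h := hw _ (odd_and_even_of_mem_levelTwo (inv_mem hM) hz)
    rw [Prod.inv_mk, map_inv, Equiv.Perm.eq_inv_iff_eq, ← h]
    exact congrArg height (M.apply_symm_apply z)

theorem natAbs_ne_natAbs_of_odd_of_even {a c : ℤ} (ha : Odd a) (hc : Even c) :
    a.natAbs ≠ c.natAbs := fun h =>
  Nat.not_even_iff_odd.2 ha.natAbs (h ▸ hc.natAbs)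

theorem upperShear_mem_heightGraph : (upperShear, A) ∈ heightGraph := by
  refine ⟨upperShear_mem_levelTwo, fun ⟨a, c⟩ ⟨ha, hc⟩ => ?_⟩
  rw [dihedralAction_A, ← height_add_two_mul_left (natAbs_ne_natAbs_of_odd_of_even ha hc),
    ← zpow_one upperShear, upperShear_zpow_apply, one_mul]

theorem lowerShear_mem_heightGraph : (lowerShear, B) ∈ heightGraph := by
  refine ⟨lowerShear_mem_levelTwo, fun ⟨a, c⟩ ⟨ha, hc⟩ => ?_⟩
  rw [dihedralAction_B, ← height_add_two_mul_right (by rintro rfl; simp at ha)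
    (natAbs_ne_natAbs_of_odd_of_even ha hc), ← zpow_one lowerShear, lowerShear_zpow_apply, one_mul]

theorem diag_mem_heightGraph (s t : ℤˣ) : (diag s t, 1) ∈ heightGraph :=
  ⟨diag_mem_levelTwo s t, fun z _ => by simp [height, diag_apply, Int.natAbs_mul]⟩

theorem exists_mem_heightGraph {M : (ℤ × ℤ) ≃ₗ[ℤ] ℤ × ℤ} (hM : M ∈ levelTwo (ℤ × ℤ)) :
    ∃ w, (M, w) ∈ heightGraph := by
  suffices h : levelTwo (ℤ × ℤ) ≤ heightGraph.map (MonoidHom.fst _ _) by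
    obtain ⟨⟨_, w⟩, hw, rfl⟩ := h hM
    exact ⟨w, hw⟩
  refine levelTwo_le_closure.trans ((Subgroup.closure_le _).2 ?_)
  rintro _ ((rfl | rfl) | ⟨u, rfl⟩)
  exacts [⟨_, upperShear_mem_heightGraph, rfl⟩, ⟨_, lowerShear_mem_heightGraph, rfl⟩,
    ⟨_, diag_mem_heightGraph u.1 u.2, rfl⟩]

theorem eq_of_mem_heightGraph {M : (ℤ × ℤ) ≃ₗ[ℤ] ℤ × ℤ} {w v : W} (hw : (M, w) ∈ heightGraph)
    (hv : (M, v) ∈ heightGraph) : w = v := by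
  have height_one_zero : height (1, 0) = 0 := evenEuclid_zero_right 1
  have height_one_two : height (1, 2) = 1 := by
    simpa [height_one_zero] using height_add_two_mul_right (a := 1) (c := 0) (by simp) (by simp)
  apply eq_of_dihedralAction
  · rw [← height_one_zero, ← hw.2 _ (by decide), ← hv.2 _ (by decide)]
  · rw [← height_one_two, ← hw.2 _ (by decide), ← hv.2 _ (by decide)]

/-! ### Affine representations of the free group -/

section AffineRep

variable {n : ℕ} {V : Type*} [AddCommGroup V]

/-- The permutation `z ↦ z + v` of `V` for `some v`, and `z ↦ -z` for `none`. -/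
def affinePerm (o : Option V) : Equiv.Perm V := o.elim (Equiv.neg V) Equiv.addRight

/-- The action of `F n` on `V` for which `x_l` is the translation by `v` if `c l = some v`, and the
inversion `z ↦ -z` if `c l = none`. -/
def affineRep (c : Fin n → Option V) : F n →* Equiv.Perm V :=
  FreeGroup.lift fun l => affinePerm (c l)

theorem affinePerm_some_apply (v z : V) : affinePerm (some v) z = z + v := rfl

theorem affinePerm_none_apply (z : V) : affinePerm none z = -z := rfl

theorem affinePerm_some_inv (v : V) : (affinePerm (some v))⁻¹ = affinePerm (some (-v)) := by
  ext z
  rw [Equiv.Perm.inv_eq_iff_eq, affinePerm_some_apply, affinePerm_some_apply, neg_add_cancel_right]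

theorem affinePerm_none_inv : (affinePerm (none : Option V))⁻¹ = affinePerm none := by
  ext z
  rw [Equiv.Perm.inv_eq_iff_eq, affinePerm_none_apply, affinePerm_none_apply, neg_neg]

theorem affineRep_of (c : Fin n → Option V) (l : Fin n) :
    affineRep c (FreeGroup.of l) = affinePerm (c l) := FreeGroup.lift_apply_of

theorem exists_affineRep_apply_eq (c : Fin n → Option V) (u : F n) : ∃ (e : ℤˣ) (v : V), ∀ z,
    affineRep c u z = v + e • z ∧ affineRep c (rev u) z = e • (z + v) := by
  induction u using FreeGroup.induction_on with
  | C1 => exact ⟨1, 0, fun z => by simp [rev_one]⟩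
  | of l =>
    rw [rev_of, affineRep_of]
    cases c l with
    | none => exact ⟨-1, 0, fun z => by simp [affinePerm_none_apply, Units.smul_def]⟩
    | some v => exact ⟨1, v, fun z => by simp [affinePerm_some_apply, add_comm]⟩
  | inv_of l h =>
    obtain ⟨e, v, h⟩ := h
    refine ⟨e, -(e • v), fun z => ?_⟩
    rw [rev_inv, map_inv, map_inv, Equiv.Perm.inv_eq_iff_eq, Equiv.Perm.inv_eq_iff_eq, (h _).1,
      (h _).2]
    simp [smul_add, smul_smul]
  | mul u u' h h' =>
    obtain ⟨e, v, h⟩ := h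
    obtain ⟨e', v', h'⟩ := h'
    refine ⟨e * e', v + e • v', fun z => ?_⟩
    rw [rev_mul, map_mul, map_mul, Equiv.Perm.mul_apply, Equiv.Perm.mul_apply, (h' _).1, (h _).1,
      (h _).2, (h' _).2]
    simp only [smul_add, mul_smul, smul_comm e' e, smul_smul e e, Int.units_mul_self, one_smul]
    exact ⟨(add_assoc _ _ _).symm, by abel⟩

theorem affineRep_rev_eq_of_eq_some {c : Fin n → Option V} {u : F n} {v : V}
    (h : affineRep c u = affinePerm (some v)) : affineRep c (rev u) = affinePerm (some v) := by
  obtain ⟨e, t, ht⟩ := exists_affineRep_apply_eq c u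
  simp only [h, affinePerm_some_apply] at ht
  have hvt : v = t := by simpa using (ht 0).1
  have he (z : V) : e • z = z := by simpa [← hvt, add_comm z] using (ht z).1.symm
  ext z
  rw [(ht z).2, he, hvt, affinePerm_some_apply]

theorem exists_affineRep_mul_mul_rev_eq {c : Fin n → Option V} {y : F n} {o : Option V}
    (h : affineRep c y = affinePerm o) (u : F n) :
    ∃ v : V, affineRep c (u * y * rev u) = affinePerm (o.map (· + (2 : ℤ) • v)) := by
  obtain ⟨e, t, ht⟩ := exists_affineRep_apply_eq c u
  have conj_apply (z : V) :
      affineRep c (u * y * rev u) z = t + e • affinePerm o (e • (z + t)) := by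
    rw [map_mul, map_mul, Equiv.Perm.mul_apply, Equiv.Perm.mul_apply, (ht z).2, h, (ht _).1]
  cases o with
  | none =>
    refine ⟨0, Equiv.ext fun z => ?_⟩
    rw [conj_apply, Option.map_none, affinePerm_none_apply, affinePerm_none_apply, smul_neg,
      smul_smul, Int.units_mul_self, one_smul]
    abel
  | some s =>
    obtain rfl | rfl := Int.units_eq_one_or e
    · refine ⟨t, Equiv.ext fun z => ?_⟩
      rw [conj_apply, Option.map_some, affinePerm_some_apply, affinePerm_some_apply, one_smul,
        one_smul]
      abel
    · refine ⟨t - s, Equiv.ext fun z => ?_⟩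
      rw [conj_apply, Option.map_some, affinePerm_some_apply, affinePerm_some_apply,
        Units.neg_smul, Units.neg_smul, one_smul, one_smul]
      abel

theorem exists_commutator_affinePerm_eq {v : V} {o o' : Option V} (ho : o = none ∨ o = some v)
    (ho' : o' = none ∨ o' = some v) :
    ∃ m : ℤ, ⁅affinePerm o, affinePerm o'⁆ = affinePerm (some ((2 * m) • v)) := by
  simp only [commutatorElement_def]
  rcases ho with rfl | rfl <;> rcases ho' with rfl | rfl <;>
    simp only [affinePerm_none_inv, affinePerm_some_inv]
  · refine ⟨0, Equiv.ext fun z => ?_⟩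
    simp [affinePerm_none_apply, affinePerm_some_apply]
  · refine ⟨-1, Equiv.ext fun z => ?_⟩
    simp only [Equiv.Perm.mul_apply, affinePerm_none_apply, affinePerm_some_apply]
    abel
  · refine ⟨1, Equiv.ext fun z => ?_⟩
    simp only [Equiv.Perm.mul_apply, affinePerm_none_apply, affinePerm_some_apply]
    abel
  · refine ⟨0, Equiv.ext fun z => ?_⟩
    simp [affinePerm_some_apply]

end AffineRep

section Intertwines

variable {G X Y Z : Type*} [Group G] {ρ : G →* Equiv.Perm X} {ρ' : G →* Equiv.Perm Y}
  {ρ'' : G →* Equiv.Perm Z} {α β : MulAut G} {M : X → Y} {N : Y → Z}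

/-- `M` carries the action `ρ` of `G` to the action of `G` through `ρ'` and the automorphism `α`. -/
def Intertwines (ρ : G →* Equiv.Perm X) (ρ' : G →* Equiv.Perm Y) (α : MulAut G) (M : X → Y) :
    Prop :=
  ∀ g, Function.Semiconj M (ρ g) (ρ' (α g))

theorem intertwines_one (ρ : G →* Equiv.Perm X) : Intertwines ρ ρ 1 id := fun _ _ => rfl

theorem Intertwines.comp (hN : Intertwines ρ' ρ'' β N) (hM : Intertwines ρ ρ' α M) :
    Intertwines ρ ρ'' (β * α) (N ∘ M) := fun g => (hM g).trans (hN (α g))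

theorem Intertwines.inv {M' : Y → X} (hM : Intertwines ρ ρ' α M)
    (hl : Function.LeftInverse M' M) (hr : Function.RightInverse M' M) :
    Intertwines ρ' ρ α⁻¹ M' := fun g => by
  have h := hM (α⁻¹ g)
  rw [MulAut.apply_inv_self] at h
  exact h.inverse_left hl hr

theorem Intertwines.eq_of_apply_eq {M' : X → Y} (hM : Intertwines ρ ρ' α M)
    (hM' : Intertwines ρ ρ' α M') {x : X} (h : M x = M' x) (hx : ∀ y, ∃ g, ρ g x = y) :
    M = M' := by
  ext y
  obtain ⟨g, rfl⟩ := hx y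
  rw [hM g x, hM' g x, h]

theorem Intertwines.surjective (hM : Intertwines ρ ρ' α M) {x : X}
    (hx : ∀ y, ∃ g, ρ' g (M x) = y) : Function.Surjective M := fun y => by
  obtain ⟨g, rfl⟩ := hx y
  exact ⟨ρ (α⁻¹ g) x, by rw [hM _ x, MulAut.apply_inv_self]⟩

theorem intertwines_of_forall_of {ι : Type*} {ρ : FreeGroup ι →* Equiv.Perm X}
    {ρ' : FreeGroup ι →* Equiv.Perm Y} {α : MulAut (FreeGroup ι)}
    (h : ∀ l, Function.Semiconj M (ρ (FreeGroup.of l)) (ρ' (α (FreeGroup.of l)))) :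
    Intertwines ρ ρ' α M := fun g => by
  induction g using FreeGroup.induction_on with
  | C1 => simpa using Function.Semiconj.id_right
  | of l => exact h l
  | inv_of l h =>
    rw [map_inv, map_inv, map_inv]
    exact h.inverses_right (Equiv.apply_symm_apply _) (Equiv.symm_apply_apply _)
  | mul g g' h h' =>
    rw [map_mul, map_mul, map_mul]
    exact h.comp_right h'

end Intertwines

theorem intertwines_affineRep {n : ℕ} {V V' : Type*} [AddCommGroup V] [AddCommGroup V']
    {c : Fin n → Option V} {ρ : F n →* Equiv.Perm V'} {α : MulAut (F n)} {M : V →ₗ[ℤ] V'}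
    (h : ∀ l, ρ (α (FreeGroup.of l)) = affinePerm ((c l).map M)) :
    Intertwines (affineRep c) ρ α M := by
  refine intertwines_of_forall_of fun l z => ?_
  rw [h, affineRep_of]
  cases c l with
  | none => exact map_neg M z
  | some v => exact map_add M z v

section PairRep

variable {n : ℕ} {i j : Fin n}

/-- The coordinates of `x_l` in the plane spanned by the basis elements `x_i` and `x_j`. -/
def pairCoord (i j l : Fin n) : Option (ℤ × ℤ) :=
  if l = i then some (1, 0) else if l = j then some (0, 1) else none

/-- The action of `F n` on `ℤ × ℤ` for which `x_i` and `x_j` are the two unit translations and the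
other members of the basis are the inversion `z ↦ -z`. -/
def pairRep (i j : Fin n) : F n →* Equiv.Perm (ℤ × ℤ) := affineRep (pairCoord i j)

theorem pairCoord_left (i j : Fin n) : pairCoord i j i = some (1, 0) := if_pos rfl

theorem pairCoord_right (hij : i ≠ j) : pairCoord i j j = some (0, 1) := by
  rw [pairCoord, if_neg hij.symm, if_pos rfl]

theorem pairCoord_of_ne {l : Fin n} (hi : l ≠ i) (hj : l ≠ j) : pairCoord i j l = none := by
  rw [pairCoord, if_neg hi, if_neg hj]

theorem pairCoord_map {τ : Fin n → Fin n} (hτ : Function.Injective τ) (i j l : Fin n) :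
    pairCoord (τ i) (τ j) (τ l) = pairCoord i j l := by
  simp only [pairCoord, hτ.eq_iff]

theorem exists_pairRep_zero_eq (hij : i ≠ j) (z : ℤ × ℤ) : ∃ g, pairRep i j g 0 = z := by
  have zpow_apply {l : Fin n} {v : ℤ × ℤ} (h : pairCoord i j l = some v) (m : ℤ) (y : ℤ × ℤ) :
      pairRep i j (FreeGroup.of l ^ m) y = y + m • v := by
    rw [pairRep, map_zpow, affineRep_of, h]
    exact DFunLike.congr_fun (Equiv.zsmul_addRight v m) y
  refine ⟨FreeGroup.of i ^ z.1 * FreeGroup.of j ^ z.2, ?_⟩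
  rw [map_mul, Equiv.Perm.mul_apply, zpow_apply (pairCoord_right hij),
    zpow_apply (pairCoord_left i j)]
  ext <;> simp

end PairRep

/-! ### Palindromic automorphisms -/

section Palindrome

variable {n : ℕ} {α : MulAut (F n)}

theorem rev_rev (g : F n) : rev (rev g) = g := by
  rw [← FreeGroup.mk_toWord (x := g), rev_mk, rev_mk, List.reverse_reverse]

theorem map_rev {G : Type*} [CommGroup G] (f : F n →* G) (u : F n) : f (rev u) = f u := by
  induction u using FreeGroup.induction_on with
  | C1 => rw [rev_one]
  | of l => rw [rev_of]
  | inv_of l _ => rw [rev_inv, rev_of]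
  | mul g h hg hh => rw [rev_mul, map_mul, map_mul, hg, hh, mul_comm]

theorem map_mul_mul_rev (f : F n →* ℤˣ) (u y : F n) : f (u * y * rev u) = f y := by
  rw [map_mul, map_mul, map_rev, mul_right_comm, Int.units_mul_self, one_mul]

theorem IsPalindrome.exists_eq {g : F n} (hg : IsPalindrome g) :
    ∃ u, g = u * rev u ∨ ∃ l, g = u * FreeGroup.of l * rev u := by
  obtain ⟨L, hL, rfl⟩ := hg
  induction hL with
  | nil => exact ⟨1, .inl (by rw [rev_one, one_mul]; rfl)⟩
  | singleton x =>
    obtain ⟨l, b⟩ := x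
    cases b with
    | true => exact ⟨1, .inr ⟨l, by rw [rev_one, one_mul, mul_one]; rfl⟩⟩
    | false =>
      refine ⟨(FreeGroup.of l)⁻¹, .inr ⟨l, ?_⟩⟩
      rw [rev_inv, rev_of, inv_mul_cancel, one_mul]
      rfl
  | @cons_concat x L _ ih =>
    have h : (FreeGroup.mk (x :: (L ++ [x])) : F n)
        = FreeGroup.mk [x] * FreeGroup.mk L * FreeGroup.mk [x] := by simp
    obtain ⟨u, hu⟩ := ih
    refine ⟨FreeGroup.mk [x] * u, ?_⟩
    rw [h, rev_mul, rev_mk, List.reverse_singleton]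
    refine hu.imp (fun hu => ?_) fun ⟨l, hu⟩ => ⟨l, ?_⟩ <;> rw [hu] <;> simp only [mul_assoc]

/-- The parity of the exponent sum of the letter `x_l`, as a sign. -/
def letterParity (l : Fin n) : F n →* ℤˣ := FreeGroup.lift fun m => if m = l then -1 else 1

theorem exists_injective_of_mem_palAut (hα : α ∈ palAut n) : ∃ τ : Fin n → Fin n,
    Function.Injective τ ∧ ∀ m, ∃ u, α (FreeGroup.of m) = u * FreeGroup.of (τ m) * rev u := by
  let parity (m : Fin n) : F n →* ℤˣ := (letterParity m).comp α⁻¹.toMonoidHom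
  have parity_apply (m l : Fin n) :
      parity m (α (FreeGroup.of l)) = if l = m then -1 else 1 := by
    simp [parity, letterParity]
  have exists_letter (m : Fin n) : ∃ l u, α (FreeGroup.of m) = u * FreeGroup.of l * rev u := by
    obtain ⟨u, hu | ⟨l, hl⟩⟩ := (hα m).exists_eq
    · have h := map_mul_mul_rev (parity m) u 1
      rw [mul_one, ← hu, parity_apply, if_pos rfl, map_one] at h
      exact absurd h (by decide)
    · exact ⟨l, u, hl⟩
  choose τ u hτ using exists_letter
  refine ⟨τ, fun m m' hm => ?_, fun m => ⟨u m, hτ m⟩⟩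
  have parity_eq (l : Fin n) : parity m (FreeGroup.of (τ l)) = if l = m then -1 else 1 := by
    rw [← parity_apply, hτ l, map_mul_mul_rev]
  have h := (parity_eq m).symm.trans ((congrArg _ (congrArg _ hm)).trans (parity_eq m'))
  by_contra hne
  rw [if_pos rfl, if_neg (Ne.symm hne)] at h
  exact absurd h (by decide)

theorem exists_mem_levelTwo_intertwines_pairRep (hα : α ∈ palAut n) {i j : Fin n} (hij : i ≠ j) :
    ∃ i' j' : Fin n, i' ≠ j' ∧ ∃ M ∈ levelTwo (ℤ × ℤ),
      Intertwines (pairRep i j) (pairRep i' j') α M := by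
  obtain ⟨τ, hτ, hατ⟩ := exists_injective_of_mem_palAut hα
  have exists_shift (l : Fin n) : ∃ v, pairRep (τ i) (τ j) (α (FreeGroup.of l)) =
      affinePerm ((pairCoord i j l).map (· + (2 : ℤ) • v)) := by
    obtain ⟨u, hu⟩ := hατ l
    rw [hu, ← pairCoord_map hτ]
    exact exists_affineRep_mul_mul_rev_eq (affineRep_of _ _) u
  choose v hv using exists_shift
  let M : ℤ × ℤ →ₗ[ℤ] ℤ × ℤ :=
    LinearMap.id + (2 : ℤ) • (LinearMap.toSpanSingleton ℤ (ℤ × ℤ) (v i)).coprod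
      (LinearMap.toSpanSingleton ℤ (ℤ × ℤ) (v j))
  have hM : Intertwines (pairRep i j) (pairRep (τ i) (τ j)) α M := by
    refine intertwines_affineRep fun l => ?_
    rw [hv]
    obtain rfl | hi := eq_or_ne l i
    · simp [pairCoord_left, M]
    obtain rfl | hj := eq_or_ne l j
    · simp [pairCoord_right hij, M]
    · simp [pairCoord_of_ne hi hj]
  have hsurj : Function.Surjective M := hM.surjective (x := 0) fun z => by
    rw [map_zero]
    exact exists_pairRep_zero_eq (hτ.ne hij) z
  exact ⟨τ i, τ j, hτ.ne hij,
    .ofBijective M (OrzechProperty.bijective_of_surjective_endomorphism M hsurj),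
    fun z => ⟨_, rfl⟩, hM⟩

end Palindrome

/-! ### The homomorphism to the free Coxeter group -/

section ElementaryAutomorphisms

variable {n : ℕ} {i j l : Fin n}

theorem P_apply_self (h : i ≠ j) :
    P i j h (FreeGroup.of i) = FreeGroup.of j * FreeGroup.of i * FreeGroup.of j := by
  simp [P, elemHom]

theorem P_apply_of_ne (h : i ≠ j) (hl : l ≠ i) :
    P i j h (FreeGroup.of l) = FreeGroup.of l := by
  simp [P, elemHom, hl]

theorem inversion_apply_self (i : Fin n) :
    inversion i (FreeGroup.of i) = (FreeGroup.of i)⁻¹ := by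
  simp [inversion, invHom]

theorem inversion_apply_of_ne (hl : l ≠ i) :
    inversion i (FreeGroup.of l) = FreeGroup.of l := by
  simp [inversion, invHom, hl]

theorem P_inv_apply_self (h : i ≠ j) : (P i j h)⁻¹ (FreeGroup.of i) =
    (FreeGroup.of j)⁻¹ * FreeGroup.of i * (FreeGroup.of j)⁻¹ := by
  change elemHom i j (-1) (FreeGroup.of i) = _
  simp [elemHom]

theorem P_inv_apply_of_ne (h : i ≠ j) (hl : l ≠ i) :
    (P i j h)⁻¹ (FreeGroup.of l) = FreeGroup.of l := by
  change elemHom i j (-1) (FreeGroup.of l) = _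
  simp [elemHom, hl]

theorem P_mem_palAut (h : i ≠ j) : P i j h ∈ palAut n := by
  intro l
  rw [isPalindrome_iff]
  obtain rfl | hl := eq_or_ne l i
  · simp only [P_apply_self, rev_mul, rev_of, mul_assoc]
  · rw [P_apply_of_ne h hl, rev_of]

end ElementaryAutomorphisms

section PairGraph

variable {n : ℕ} {i j : Fin n} {φ : MulAut (F n)} {M : (ℤ × ℤ) ≃ₗ[ℤ] ℤ × ℤ} {w : W}

/-- The pairs `(φ, w)` such that `φ` acts on the translations of `pairRep i j` by some `M` in the
level two congruence subgroup, and `M` acts on heights by `w`. It contains the graph of `ρ`. -/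
def pairGraph (i j : Fin n) : Subgroup (MulAut (F n) × W) where
  carrier := {p | ∃ M, (M, p.2) ∈ heightGraph ∧ Intertwines (pairRep i j) (pairRep i j) p.1 M}
  one_mem' := ⟨1, one_mem heightGraph, intertwines_one _⟩
  mul_mem' := by
    rintro _ _ ⟨M, hM, hM'⟩ ⟨N, hN, hN'⟩
    exact ⟨M * N, mul_mem hM hN, hM'.comp hN'⟩
  inv_mem' := by
    rintro _ ⟨M, hM, hM'⟩
    exact ⟨M⁻¹, inv_mem hM, hM'.inv M.symm_apply_apply M.apply_symm_apply⟩

theorem eq_of_mem_pairGraph (hij : i ≠ j) {v : W} (hw : (φ, w) ∈ pairGraph i j)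
    (hv : (φ, v) ∈ pairGraph i j) : w = v := by
  obtain ⟨M, hM, hM'⟩ := hw
  obtain ⟨N, hN, hN'⟩ := hv
  have h := hM'.eq_of_apply_eq hN' ((map_zero M).trans (map_zero N).symm)
    (exists_pairRep_zero_eq hij)
  exact eq_of_mem_heightGraph hM (DFunLike.coe_injective h ▸ hN)

theorem conj_mem_pairGraph {i' j' : Fin n} {α : MulAut (F n)}
    (hα : Intertwines (pairRep i j) (pairRep i' j') α M) (hM : M ∈ levelTwo (ℤ × ℤ))
    (hφ : (φ, 1) ∈ pairGraph i' j') : (α⁻¹ * φ * α, 1) ∈ pairGraph i j := by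
  obtain ⟨N, hN, hN'⟩ := hφ
  obtain ⟨w, hw⟩ := exists_mem_heightGraph hM
  refine ⟨M⁻¹ * N * M, ?_,
    ((hα.inv M.symm_apply_apply M.apply_symm_apply).comp hN').comp hα⟩
  simpa using mul_mem (mul_mem (inv_mem hw) hN) hw

theorem mem_pairGraph_of_left (hij : i ≠ j) (hM : (M, w) ∈ heightGraph)
    (hM' : M (0, 1) = (0, 1)) (hφ : ∀ l ≠ i, φ (FreeGroup.of l) = FreeGroup.of l)
    (hi : pairRep i j (φ (FreeGroup.of i)) = affinePerm (some (M (1, 0)))) :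
    (φ, w) ∈ pairGraph i j := by
  refine ⟨M, hM, intertwines_affineRep (M := M.toLinearMap) fun l => ?_⟩
  obtain rfl | hli := eq_or_ne l i
  · rw [hi, pairCoord_left]
    rfl
  rw [hφ l hli, pairRep, affineRep_of]
  obtain rfl | hlj := eq_or_ne l j
  · rw [pairCoord_right hij, Option.map_some, LinearEquiv.coe_coe, hM']
  · rw [pairCoord_of_ne hli hlj, Option.map_none]

theorem mem_pairGraph_of_right (hij : i ≠ j) (hM : (M, w) ∈ heightGraph)
    (hM' : M (1, 0) = (1, 0)) (hφ : ∀ l ≠ j, φ (FreeGroup.of l) = FreeGroup.of l)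
    (hj : pairRep i j (φ (FreeGroup.of j)) = affinePerm (some (M (0, 1)))) :
    (φ, w) ∈ pairGraph i j := by
  refine ⟨M, hM, intertwines_affineRep (M := M.toLinearMap) fun l => ?_⟩
  obtain rfl | hlj := eq_or_ne l j
  · rw [hj, pairCoord_right hij]
    rfl
  rw [hφ l hlj, pairRep, affineRep_of]
  obtain rfl | hli := eq_or_ne l i
  · rw [pairCoord_left, Option.map_some, LinearEquiv.coe_coe, hM']
  · rw [pairCoord_of_ne hli hlj, Option.map_none]

theorem mem_pairGraph_of_other {a : Fin n} (hai : a ≠ i) (haj : a ≠ j)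
    (hφ : ∀ l ≠ a, φ (FreeGroup.of l) = FreeGroup.of l)
    (ha : pairRep i j (φ (FreeGroup.of a)) = affinePerm none) : (φ, 1) ∈ pairGraph i j := by
  refine ⟨1, one_mem heightGraph, intertwines_affineRep (M := LinearMap.id) fun l => ?_⟩
  rw [LinearMap.id_coe, Option.map_id_apply]
  obtain rfl | hla := eq_or_ne l a
  · rw [ha, pairCoord_of_ne hai haj]
  · rw [hφ l hla, pairRep, affineRep_of]

theorem pairRep_left (i j : Fin n) :
    pairRep i j (FreeGroup.of i) = affinePerm (some (1, 0)) := by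
  rw [pairRep, affineRep_of, pairCoord_left]

theorem pairRep_right (hij : i ≠ j) :
    pairRep i j (FreeGroup.of j) = affinePerm (some (0, 1)) := by
  rw [pairRep, affineRep_of, pairCoord_right hij]

theorem pairRep_of_ne {l : Fin n} (hi : l ≠ i) (hj : l ≠ j) :
    pairRep i j (FreeGroup.of l) = affinePerm none := by
  rw [pairRep, affineRep_of, pairCoord_of_ne hi hj]

theorem pairRep_mul_mul_rev {a : Fin n} (hai : a ≠ i) (haj : a ≠ j) (u : F n) :
    pairRep i j (u * FreeGroup.of a * rev u) = affinePerm none := by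
  obtain ⟨_, h⟩ := exists_affineRep_mul_mul_rev_eq (pairRep_of_ne hai haj) u
  exact h

theorem P_right_left_mem_pairGraph (hij : i ≠ j) : (P j i hij.symm, A) ∈ pairGraph i j := by
  refine mem_pairGraph_of_right hij upperShear_mem_heightGraph ?_
    (fun l => P_apply_of_ne hij.symm) ?_
  · simpa using upperShear_zpow_apply 1 (1, 0)
  · have h : upperShear (0, 1) = (2, 1) := by simpa using upperShear_zpow_apply 1 (0, 1)
    rw [P_apply_self, map_mul, map_mul, pairRep_left, pairRep_right hij, h]
    ext z <;> simp [affinePerm_some_apply, add_assoc]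

theorem P_left_right_mem_pairGraph (hij : i ≠ j) : (P i j hij, B) ∈ pairGraph i j := by
  refine mem_pairGraph_of_left hij lowerShear_mem_heightGraph ?_
    (fun l => P_apply_of_ne hij) ?_
  · simpa using lowerShear_zpow_apply 1 (0, 1)
  · have h : lowerShear (1, 0) = (1, 2) := by simpa using lowerShear_zpow_apply 1 (1, 0)
    rw [P_apply_self, map_mul, map_mul, pairRep_left, pairRep_right hij, h]
    ext z <;> simp [affinePerm_some_apply, add_assoc]

theorem P_mem_pairGraph (hij : i ≠ j) {a b : Fin n} (hab : a ≠ b) (hne : ¬(a = i ∧ b = j))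
    (hne' : ¬(a = j ∧ b = i)) : (P a b hab, 1) ∈ pairGraph i j := by
  obtain rfl | hai := eq_or_ne a i
  · refine mem_pairGraph_of_left hij (diag_mem_heightGraph (-1) 1) (by simp [diag_apply])
      (fun l => P_apply_of_ne hab) ?_
    rw [P_apply_self, map_mul, map_mul, pairRep_left,
      pairRep_of_ne hab.symm fun h => hne ⟨rfl, h⟩]
    ext z <;> simp [diag_apply, affinePerm_some_apply, affinePerm_none_apply, add_comm]
  obtain rfl | haj := eq_or_ne a j
  · refine mem_pairGraph_of_right hij (diag_mem_heightGraph 1 (-1)) (by simp [diag_apply])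
      (fun l => P_apply_of_ne hab) ?_
    rw [P_apply_self, map_mul, map_mul, pairRep_right hij,
      pairRep_of_ne (fun h => hne' ⟨rfl, h⟩) hab.symm]
    ext z <;> simp [diag_apply, affinePerm_some_apply, affinePerm_none_apply, add_comm]
  · refine mem_pairGraph_of_other hai haj (fun l => P_apply_of_ne hab) ?_
    simpa only [P_apply_self, rev_of] using pairRep_mul_mul_rev hai haj (FreeGroup.of b)

theorem inversion_mem_pairGraph (hij : i ≠ j) (a : Fin n) :
    (inversion a, 1) ∈ pairGraph i j := by
  obtain rfl | hai := eq_or_ne a i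
  · refine mem_pairGraph_of_left hij (diag_mem_heightGraph (-1) 1) (by simp [diag_apply])
      (fun l => inversion_apply_of_ne) ?_
    rw [inversion_apply_self, map_inv, pairRep_left, affinePerm_some_inv]
    simp [diag_apply]
  obtain rfl | haj := eq_or_ne a j
  · refine mem_pairGraph_of_right hij (diag_mem_heightGraph 1 (-1)) (by simp [diag_apply])
      (fun l => inversion_apply_of_ne) ?_
    rw [inversion_apply_self, map_inv, pairRep_right hij, affinePerm_some_inv]
    simp [diag_apply]
  · refine mem_pairGraph_of_other hai haj (fun l => inversion_apply_of_ne) ?_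
    rw [inversion_apply_self, map_inv, pairRep_of_ne hai haj, affinePerm_none_inv]

theorem exists_pairRep_rev_commutator_mul {v t : ℤ × ℤ} {a b c : Fin n}
    (ha : pairCoord i j a = some t) (hb : pairCoord i j b = none ∨ pairCoord i j b = some v)
    (hc : pairCoord i j c = none ∨ pairCoord i j c = some v) :
    ∃ m : ℤ, pairRep i j (rev ⁅FreeGroup.of b, FreeGroup.of c⁆ * FreeGroup.of a *
      ⁅FreeGroup.of b, FreeGroup.of c⁆) = affinePerm (some (t + (2 * (2 * m)) • v)) := by
  obtain ⟨m, hm⟩ := exists_commutator_affinePerm_eq hb hc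
  have h : pairRep i j ⁅FreeGroup.of b, FreeGroup.of c⁆ = affinePerm (some ((2 * m) • v)) := by
    rw [map_commutatorElement, pairRep, affineRep_of, affineRep_of, hm]
  refine ⟨m, Equiv.ext fun z => ?_⟩
  rw [map_mul, map_mul, h, pairRep, affineRep_rev_eq_of_eq_some h, affineRep_of, ha]
  simp only [Equiv.Perm.mul_apply, affinePerm_some_apply, mul_smul, two_smul]
  abel

theorem mem_pairGraph_of_apply_eq_rev_commutator_mul (hij : i ≠ j) {a b c : Fin n} (hab : a ≠ b)
    (hac : a ≠ c) (hφa : φ (FreeGroup.of a) = rev ⁅FreeGroup.of b, FreeGroup.of c⁆ *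
      FreeGroup.of a * ⁅FreeGroup.of b, FreeGroup.of c⁆)
    (hφ : ∀ l ≠ a, φ (FreeGroup.of l) = FreeGroup.of l) : (φ, 1) ∈ pairGraph i j := by
  have sq_zpow {C : W} (hC : C * C = 1) (m : ℤ) : C ^ (2 * m) = 1 := by
    rw [zpow_mul, zpow_two, hC, one_zpow]
  obtain rfl | hai := eq_or_ne a i
  · have hcoord {l : Fin n} (hl : a ≠ l) :
        pairCoord a j l = none ∨ pairCoord a j l = some (0, 1) := by
      obtain rfl | hlj := eq_or_ne l j
      exacts [.inr (pairCoord_right hij), .inl (pairCoord_of_ne hl.symm hlj)]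
    obtain ⟨m, hm⟩ :=
      exists_pairRep_rev_commutator_mul (pairCoord_left a j) (hcoord hab) (hcoord hac)
    rw [← sq_zpow B_mul_B m]
    refine mem_pairGraph_of_left (M := lowerShear ^ (2 * m)) hij
      (zpow_mem lowerShear_mem_heightGraph (2 * m)) ?_ hφ ?_
    · simp [lowerShear_zpow_apply]
    · rw [hφa, hm, lowerShear_zpow_apply]
      simp
  obtain rfl | haj := eq_or_ne a j
  · have hcoord {l : Fin n} (hl : a ≠ l) :
        pairCoord i a l = none ∨ pairCoord i a l = some (1, 0) := by
      obtain rfl | hli := eq_or_ne l i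
      exacts [.inr (pairCoord_left l a), .inl (pairCoord_of_ne hli hl.symm)]
    obtain ⟨m, hm⟩ :=
      exists_pairRep_rev_commutator_mul (pairCoord_right hij) (hcoord hab) (hcoord hac)
    rw [← sq_zpow A_mul_A m]
    refine mem_pairGraph_of_right (M := upperShear ^ (2 * m)) hij
      (zpow_mem upperShear_mem_heightGraph (2 * m)) ?_ hφ ?_
    · simp [upperShear_zpow_apply]
    · rw [hφa, hm, upperShear_zpow_apply]
      simp
  · refine mem_pairGraph_of_other hai haj hφ ?_
    rw [hφa]
    simpa only [rev_rev] using
      pairRep_mul_mul_rev hai haj (rev ⁅FreeGroup.of b, FreeGroup.of c⁆)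

theorem IsDoubledCommutatorTransvection.mem_pairGraph (hij : i ≠ j)
    (hφ : IsDoubledCommutatorTransvection φ) : (φ, 1) ∈ pairGraph i j := by
  obtain ⟨-, α, hα, a, b, c, hab, hac, -, hφa, hφ⟩ := hφ
  obtain ⟨i', j', hij', M, hM, hαM⟩ :=
    exists_mem_levelTwo_intertwines_pairRep (inv_mem hα) hij
  have hconj : (α⁻¹ * φ * α, 1) ∈ pairGraph i' j' := by
    refine mem_pairGraph_of_apply_eq_rev_commutator_mul hij' hab hac ?_ fun l hl => ?_
    · rw [MulAut.mul_apply, MulAut.mul_apply, hφa, ← map_commutatorElement, rev_map α hα,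
        ← map_mul, ← map_mul, MulAut.inv_apply_self]
    · rw [MulAut.mul_apply, MulAut.mul_apply, hφ l hl, MulAut.inv_apply_self]
  simpa [mul_assoc] using conj_mem_pairGraph hαM hM hconj

theorem mem_pairGraph_of_mem_doubledCommutatorSubgroup (hij : i ≠ j)
    (hφ : φ ∈ doubledCommutatorSubgroup n) : (φ, 1) ∈ pairGraph i j := by
  have h : doubledCommutatorSubgroup n ≤ (pairGraph i j).comap (MonoidHom.inl _ W) :=
    (Subgroup.closure_le _).2 fun _ => IsDoubledCommutatorTransvection.mem_pairGraph hij
  exact h hφ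

theorem exists_mem_pairGraph (hij : i ≠ j) (hφ : φ ∈ purePalAut n) :
    ∃ w, (φ, w) ∈ pairGraph i j := by
  suffices h : purePalAut n ≤ (pairGraph i j).map (MonoidHom.fst _ W) by
    obtain ⟨⟨_, w⟩, hw, rfl⟩ := h hφ
    exact ⟨w, hw⟩
  refine (Subgroup.closure_le _).2 ?_
  rintro _ (⟨a, b, hab, rfl⟩ | ⟨a, rfl⟩)
  · by_cases h : a = i ∧ b = j
    · obtain ⟨rfl, rfl⟩ := h
      exact ⟨_, P_left_right_mem_pairGraph hab, rfl⟩
    by_cases h' : a = j ∧ b = i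
    · obtain ⟨rfl, rfl⟩ := h'
      exact ⟨_, P_right_left_mem_pairGraph hab.symm, rfl⟩
    · exact ⟨_, P_mem_pairGraph hij hab h h', rfl⟩
  · exact ⟨_, inversion_mem_pairGraph hij a, rfl⟩

theorem exists_purePalAut_hom (hij : i ≠ j) : ∃ ρ : purePalAut n →* W,
    ∀ (φ : purePalAut n) (w : W), ((φ : MulAut (F n)), w) ∈ pairGraph i j → ρ φ = w := by
  obtain ⟨ρ, hρ⟩ := Subgroup.exists_eq_graph
    (G := (pairGraph i j).comap ((purePalAut n).subtype.prodMap (MonoidHom.id W))) <| by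
      refine ⟨fun ⟨⟨φ, w⟩, hw⟩ ⟨⟨ψ, v⟩, hv⟩ h => ?_, fun φ => ?_⟩
      · obtain rfl : φ = ψ := h
        obtain rfl := eq_of_mem_pairGraph hij hw hv
        rfl
      · obtain ⟨w, hw⟩ := exists_mem_pairGraph hij φ.2
        exact ⟨⟨(φ, w), hw⟩, rfl⟩
  exact ⟨ρ, fun φ w h => (MonoidHom.mem_graph (x := (φ, w))).1 (hρ ▸ h)⟩

theorem chi2_mem_pairGraph {k : Fin n} (hij : i ≠ j) (hik : i ≠ k) (hjk : j ≠ k) :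
    ((chi2 i j k hij hik hjk : MulAut (F n)), (B * A) ^ 2) ∈ pairGraph i j := by
  have hP {a b : Fin n} (hab : a ≠ b) (h : a = k ∨ b = k) : (P a b hab, 1) ∈ pairGraph i j :=
    P_mem_pairGraph hij hab (by grind) (by grind)
  have h := pow_mem (mul_mem (mul_mem (mul_mem (mul_mem (mul_mem (hP hjk (.inr rfl))
    (inv_mem (hP hik (.inr rfl)))) (hP hik.symm (.inl rfl))) (hP hjk.symm (.inl rfl)))
    (P_left_right_mem_pairGraph hij)) (inv_mem (P_right_left_mem_pairGraph hij))) 2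
  simpa [chi2, pureP, A_inv] using h

theorem chi2_notMem_doubledCommutatorSubgroup {k : Fin n} (hij : i ≠ j) (hik : i ≠ k)
    (hjk : j ≠ k) : (chi2 i j k hij hik hjk : MulAut (F n)) ∉ doubledCommutatorSubgroup n :=
  fun h => sq_B_mul_A_ne_one <| eq_of_mem_pairGraph hij (chi2_mem_pairGraph hij hik hjk)
    (mem_pairGraph_of_mem_doubledCommutatorSubgroup hij h)

end PairGraph

/-! ### The palindromic Torelli group -/

section BasisValues

variable {n : ℕ} {i j k : Fin n} {C : Type*} [AddCommGroup C]

/-- The values on the basis of a homomorphism from `F n` to an additive commutative group. They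
determine it, and composition with an automorphism acts on them as on `Fin n → C`. -/
def basisValues (f : F n →* Multiplicative C) (l : Fin n) : C :=
  (f (FreeGroup.of l)).toAdd

theorem basisValues_injective :
    Function.Injective (basisValues : (F n →* Multiplicative C) → Fin n → C) :=
  fun _ _ h => FreeGroup.ext_hom _ _ (congrFun h)

theorem basisValues_comp_P (f : F n →* Multiplicative C) (h : i ≠ j) :
    basisValues (f.comp (P i j h).toMonoidHom) =
      Function.update (basisValues f) i (basisValues f i + (2 : ℤ) • basisValues f j) := by
  funext l
  obtain rfl | hl := eq_or_ne l i
  · simp [basisValues, P_apply_self]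
    abel
  · simp [basisValues, P_apply_of_ne h hl, hl]

theorem basisValues_comp_P_inv (f : F n →* Multiplicative C) (h : i ≠ j) :
    basisValues (f.comp (P i j h)⁻¹.toMonoidHom) =
      Function.update (basisValues f) i (basisValues f i - (2 : ℤ) • basisValues f j) := by
  funext l
  change (f ((P i j h)⁻¹ (FreeGroup.of l))).toAdd = _
  obtain rfl | hl := eq_or_ne l i
  · rw [P_inv_apply_self]
    simp [basisValues]
    abel
  · rw [P_inv_apply_of_ne h hl]
    simp [basisValues, hl]

theorem comp_mul_toMonoidHom (f : F n →* Multiplicative C) (φ ψ : MulAut (F n)) :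
    f.comp (φ * ψ).toMonoidHom = (f.comp φ.toMonoidHom).comp ψ.toMonoidHom := rfl

/-- The automorphism of which `χ₂` is the square. It acts on the abelianisation as an
involution. -/
def chi2Root (i j k : Fin n) (hij : i ≠ j) (hik : i ≠ k) (hjk : j ≠ k) : MulAut (F n) :=
  P j k hjk * (P i k hik)⁻¹ * P k i hik.symm * P k j hjk.symm * P i j hij * (P j i hij.symm)⁻¹

theorem basisValues_comp_chi2Root (f : F n →* Multiplicative C) (hij : i ≠ j) (hik : i ≠ k)
    (hjk : j ≠ k) (l : Fin n) :
    basisValues (f.comp (chi2Root i j k hij hik hjk).toMonoidHom) l =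
      if l = i then basisValues f i + (2 : ℤ) • basisValues f j + (2 : ℤ) • basisValues f k
      else if l = j then (-2 : ℤ) • basisValues f i - (3 : ℤ) • basisValues f j -
        (2 : ℤ) • basisValues f k
      else if l = k then (2 : ℤ) • basisValues f i + (2 : ℤ) • basisValues f j + basisValues f k
      else basisValues f l := by
  simp only [chi2Root, comp_mul_toMonoidHom, basisValues_comp_P, basisValues_comp_P_inv,
    Function.update_apply]
  split_ifs <;> simp_all <;> abel

theorem comp_chi2_eq (f : F n →* Multiplicative C) (hij : i ≠ j) (hik : i ≠ k) (hjk : j ≠ k) :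
    f.comp (chi2 i j k hij hik hjk : MulAut (F n)).toMonoidHom = f := by
  have hchi2 : (chi2 i j k hij hik hjk : MulAut (F n)) = chi2Root i j k hij hik hjk ^ 2 := rfl
  refine basisValues_injective (funext fun l => ?_)
  simp only [hchi2, pow_two, comp_mul_toMonoidHom, basisValues_comp_chi2Root,
    if_pos, if_neg hij.symm, if_neg hik.symm, if_neg hjk.symm]
  split_ifs with hi hj hk
  · rw [hi]
    abel
  · rw [hj]
    abel
  · rw [hk]
    abel
  · rfl

theorem chi2_mem_palTorelli (hij : i ≠ j) (hik : i ≠ k) (hjk : j ≠ k) :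
    (chi2 i j k hij hik hjk : MulAut (F n)) ∈ palTorelli n := by
  constructor
  · exact pow_mem (mul_mem (mul_mem (mul_mem (mul_mem (mul_mem (P_mem_palAut hjk)
      (inv_mem (P_mem_palAut hik))) (P_mem_palAut hik.symm)) (P_mem_palAut hjk.symm))
      (P_mem_palAut hij)) (inv_mem (P_mem_palAut hij.symm))) 2
  · let f : F n →* Multiplicative (Additive (Abelianization (F n))) := Abelianization.of
    exact DFunLike.congr_fun (comp_chi2_eq f hij hik hjk)

end BasisValues

theorem doubledCommutatorSubgroup_le_palTorelli (n : ℕ) :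
    doubledCommutatorSubgroup n ≤ palTorelli n :=
  (Subgroup.closure_le _).2 fun _ h => h.1

theorem doubledCommutatorSubgroup_lt_palTorelli {n : ℕ} {i j k : Fin n} (hij : i ≠ j)
    (hik : i ≠ k) (hjk : j ≠ k) : doubledCommutatorSubgroup n < palTorelli n :=
  SetLike.lt_iff_le_and_exists.2 ⟨doubledCommutatorSubgroup_le_palTorelli n, _,
    chi2_mem_palTorelli hij hik hjk, chi2_notMem_doubledCommutatorSubgroup hij hik hjk⟩

/-! ### The homomorphism of the presented group -/

section PresentedToW

variable {n : ℕ} {i j k a b c d : Fin n}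

/-- The images under `σ` of the generators of the presentation. -/
def genToW (i j : Fin n) : Gen n → W
  | .S a b _ => if a = i ∧ b = j then A else if a = j ∧ b = i then B else 1
  | .O _ => 1

theorem lift_genToW_fS_sq (h : a ≠ b) : FreeGroup.lift (genToW i j) (fS a b h) ^ 2 = 1 := by
  simp only [fS, FreeGroup.lift_apply_of, genToW]
  split_ifs
  exacts [(pow_two A).trans A_mul_A, (pow_two B).trans B_mul_B, one_pow 2]

theorem lift_genToW_fO (a : Fin n) : FreeGroup.lift (genToW i j) (fO a) = 1 := by
  simp only [fO, FreeGroup.lift_apply_of, genToW]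

theorem commutator_lift_genToW_fS (h : a ≠ b) (h' : c ≠ d) (hne : ¬(a = d ∧ b = c)) :
    ⁅FreeGroup.lift (genToW i j) (fS a b h), FreeGroup.lift (genToW i j) (fS c d h')⁆ = 1 := by
  simp only [fS, FreeGroup.lift_apply_of, genToW]
  split_ifs <;> simp_all

theorem lift_genToW_eq_one_of_relator {r : FreeGroup (Gen n)} (h : Relator n r) :
    FreeGroup.lift (genToW i j) r = 1 := by
  cases h <;> simp only [map_pow, map_mul, map_inv, map_commutatorElement, lift_genToW_fO,
    lift_genToW_fS_sq, one_mul, one_pow, commutatorElement_one_left, inv_one, mul_one]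
  all_goals refine commutator_lift_genToW_fS _ _ fun h => ?_
  all_goals exact absurd h.1 (by assumption)

/-- The homomorphism `σ`. -/
def presentedToW (i j : Fin n) : Q n →* W :=
  PresentedGroup.toGroup (f := genToW i j) fun _ h => lift_genToW_eq_one_of_relator h

theorem presentedToW_qS (h : a ≠ b) : presentedToW i j (qS a b h) =
    if a = i ∧ b = j then A else if a = j ∧ b = i then B else 1 :=
  PresentedGroup.toGroup.of _

theorem presentedToW_qO (a : Fin n) : presentedToW i j (qO a) = 1 :=
  PresentedGroup.toGroup.of _

theorem presentedToW_xi (hij : i ≠ j) (hik : i ≠ k) (hjk : j ≠ k) :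
    presentedToW i j (xi i j k hij hik hjk) = (B * A) ^ 2 := by
  simp [xi, presentedToW_qS, hij.symm, hik.symm, hjk.symm, A_inv]

end PresentedToW

end PalTorelli

theorem mainTheorem8 (n : ℕ) (hn : 3 ≤ n) :
    PalTorelli.doubledCommutatorSubgroup n < PalTorelli.palTorelli n ∧
    ∀ (i j k : Fin n) (hij : i ≠ j) (hik : i ≠ k) (hjk : j ≠ k),
      ((PalTorelli.chi2 i j k hij hik hjk : MulAut (PalTorelli.F n)) ∈ PalTorelli.palTorelli n ∧
        (PalTorelli.chi2 i j k hij hik hjk : MulAut (PalTorelli.F n)) ∉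
          PalTorelli.doubledCommutatorSubgroup n) ∧
      (∃ ρ : PalTorelli.purePalAut n →* PalTorelli.W,
        Function.Surjective ρ ∧
        (∀ φ : PalTorelli.purePalAut n,
          (φ : MulAut (PalTorelli.F n)) ∈ PalTorelli.doubledCommutatorSubgroup n → ρ φ = 1) ∧
        ρ (PalTorelli.pureP j i hij.symm) = PalTorelli.A ∧
        ρ (PalTorelli.pureP i j hij) = PalTorelli.B ∧
        (∀ (a b : Fin n) (hab : a ≠ b), ¬(a = i ∧ b = j) → ¬(a = j ∧ b = i) →
          ρ (PalTorelli.pureP a b hab) = 1) ∧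
        (∀ a : Fin n, ρ (PalTorelli.pureInversion a) = 1) ∧
        ρ (PalTorelli.chi2 i j k hij hik hjk) ≠ 1) ∧
      (∃ σ : PalTorelli.Q n →* PalTorelli.W,
        Function.Surjective σ ∧
        σ (PalTorelli.qS i j hij) = PalTorelli.A ∧
        σ (PalTorelli.qS j i hij.symm) = PalTorelli.B ∧
        (∀ (a b : Fin n) (hab : a ≠ b), ¬(a = i ∧ b = j) → ¬(a = j ∧ b = i) →
          σ (PalTorelli.qS a b hab) = 1) ∧
        (∀ a : Fin n, σ (PalTorelli.qO a) = 1) ∧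
        σ (PalTorelli.xi i j k hij hik hjk) ≠ 1) := by
  open PalTorelli in
  refine ⟨doubledCommutatorSubgroup_lt_palTorelli (i := ⟨0, by omega⟩) (j := ⟨1, by omega⟩)
    (k := ⟨2, by omega⟩) (by simp) (by simp) (by simp), fun i j k hij hik hjk => ?_⟩
  obtain ⟨ρ, hρ⟩ := exists_purePalAut_hom hij
  have hρA : ρ (pureP j i hij.symm) = A := hρ _ _ (P_right_left_mem_pairGraph hij)
  have hρB : ρ (pureP i j hij) = B := hρ _ _ (P_left_right_mem_pairGraph hij)
  have hσA : presentedToW i j (qS i j hij) = A := by simp [presentedToW_qS]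
  have hσB : presentedToW i j (qS j i hij.symm) = B := by simp [presentedToW_qS, hij.symm]
  refine ⟨⟨chi2_mem_palTorelli hij hik hjk, chi2_notMem_doubledCommutatorSubgroup hij hik hjk⟩,
    ⟨ρ, surjective_of_apply_eq_A_of_apply_eq_B ρ hρA hρB,
      fun φ hφ => hρ φ 1 (mem_pairGraph_of_mem_doubledCommutatorSubgroup hij hφ), hρA, hρB,
      fun a b hab h h' => hρ _ _ (P_mem_pairGraph hij hab h h'),
      fun a => hρ _ _ (inversion_mem_pairGraph hij a), ?_⟩,
    ⟨presentedToW i j, surjective_of_apply_eq_A_of_apply_eq_B _ hσA hσB, hσA, hσB,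
      fun a b hab h h' => by rw [presentedToW_qS, if_neg h, if_neg h'], presentedToW_qO, ?_⟩⟩
  · rw [hρ _ _ (chi2_mem_pairGraph hij hik hjk)]
    exact sq_B_mul_A_ne_one
  · rw [presentedToW_xi]
    exact sq_B_mul_A_ne_one
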